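/- Let $r,n,s,f,A$ be integers with $n>0$, $r\ge 0$ and $f(r-s)\equiv 0 \pmod n$. Let $$E=E(r,n,s,A)=\langle t,y \mid t^n,\ y^r t^A y^{-s} t^{-A}\rangle ,$$ and let $\nu^f:E\to\langle t\mid t^n\rangle\cong\mathbb{Z}/n$ be the homomorphism with $\nu^f(t)=t$ and $\nu^f(y)=t^f$. For a word $w$ in the free group on $x_0,\dots,x_{n-1}$ (subscripts modulo $n$), with shift automorphism $\theta(x_i)=x_{i+1}$, let $G_n(w)=\langle x_0,\dots,x_{n-1}\mid w,\theta(w),\dots,\theta^{n-1}(w)\rangle$ be the cyclically presented group. Let $G=\ker\nu^f$, equivalently (up to isomorphism) $G=G_n(w)$ where $$w=\begin{cases}\prod_{i=0}^{r-1}x_{if}\Bigl(\prod_{i=0}^{s-1}x_{A+if}\Bigr)^{-1} & \text{if } s\ge 0,\\[4pt] \prod_{i=0}^{r-1}x_{if}\,\prod_{i=0}^{|s|-1}x_{A+(r+i)f} & \text{if } s<0.\end{cases}$$ Call a group large if it has a subgroup of finite index that surjects onto the free group $F_2$ of rank two, and virtually abelian if it has an abelian subgroup of finite index. Then $E$ is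 large or virtually abelian, and $G$ (in either description) is large or virtually abelian. Consequently every group of type $\mathfrak{M}$ is large or virtually abelian, where a group is of type $\mathfrak{M}$ if it is isomorphic to $G_n(w)$ for some $n>0$ and some $w=\Lambda(r_1,f)\,\theta^a(\Lambda(r_2,f))^{\varepsilon}$ with $r_1,r_2\ge 0$, $f\in\mathbb{Z}$, $0\le a\le n-1$, $\varepsilon=\pm1$ and $(r_1+\varepsilon r_2)f\equiv 0\pmod n$; here $\Lambda(r,f)=\prod_{i=0}^{r-1}x_{if}$. -/

import Mathlib

namespace CycPres

/-- The shift automorphism `θ` of the free group on `x_i`, `i ∈ ℤ/n`, with `θ(x_i) = x_{i+1}`. -/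
def shift (n : ℕ) : MulAut (FreeGroup (ZMod n)) :=
  FreeGroup.freeGroupCongr (Equiv.addRight (1 : ZMod n))

/-- The relators `w, θ(w), …, θ^{n-1}(w)`. -/
def relators (n : ℕ) (w : FreeGroup (ZMod n)) : Set (FreeGroup (ZMod n)) :=
  {v | ∃ i : ℕ, i < n ∧ v = (shift n ^ i) w}

/-- The cyclically presented group `G_n(w)`. -/
abbrev CycPresGroup (n : ℕ) (w : FreeGroup (ZMod n)) : Type :=
  PresentedGroup (relators n w)

/-- The word `Λ(r, f) = x_0 x_f x_{2f} ⋯ x_{(r-1)f}`. -/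
def block (n r : ℕ) (f : ℤ) : FreeGroup (ZMod n) :=
  ((List.range r).map fun i => FreeGroup.of (((i : ℤ) * f : ℤ) : ZMod n)).prod

/-- `G` is of type `𝔐`: it is isomorphic to `G_n(w)` for a word
`w = Λ(r₁, f) · θ^a(Λ(r₂, f))^ε` with `ε = ±1` and `(r₁ + ε r₂) f ≡ 0 mod n`. -/
def IsTypeM (G : Type*) [Group G] : Prop :=
  ∃ (n r₁ r₂ a : ℕ) (f : ℤ) (ε : ℤˣ), 0 < n ∧ a < n ∧
    ((r₁ : ℤ) + (ε : ℤ) * r₂) * f ≡ 0 [ZMOD n] ∧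
    Nonempty (G ≃* CycPresGroup n (block n r₁ f * ((shift n ^ a) (block n r₂ f)) ^ (ε : ℤ)))

/-- The word defining the group of type `𝔐` with parameters `(r, n, s, f, A)`:
`∏_{i<r} x_{if} (∏_{i<s} x_{A+if})⁻¹` if `s ≥ 0`, and
`∏_{i<r} x_{if} ∏_{i<|s|} x_{A+(r+i)f}` if `s < 0`. -/
def wordM (r n : ℕ) (s f A : ℤ) : FreeGroup (ZMod n) :=
  if 0 ≤ s then block n r f * ((shift n ^ A) (block n s.natAbs f))⁻¹
  else block n r f * (shift n ^ (A + f * r)) (block n s.natAbs f)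

/-- The two generators of the shift extension. -/
inductive Gen
  | t
  | y

/-- The relators `t^n` and `y^r t^A y^{-s} t^{-A}`. -/
def extRelators (r : ℤ) (n : ℕ) (s A : ℤ) : Set (FreeGroup Gen) :=
  {FreeGroup.of Gen.t ^ n,
    FreeGroup.of Gen.y ^ r * FreeGroup.of Gen.t ^ A *
      FreeGroup.of Gen.y ^ (-s) * FreeGroup.of Gen.t ^ (-A)}

/-- The group `E(r, n, s, A) = ⟨t, y | t^n, y^r t^A y^{-s} t^{-A}⟩`. -/
abbrev ExtGroup (r : ℤ) (n : ℕ) (s A : ℤ) : Type :=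
  PresentedGroup (extRelators r n s A)

/-- The images of the generators under `ν^f`; the cyclic group `⟨t | t^n⟩` is written as
`ℤ/n` in multiplicative notation, `t` being the class of `1`. -/
def retractionGen (n : ℕ) (f : ℤ) : Gen → Multiplicative (ZMod n)
  | Gen.t => Multiplicative.ofAdd 1
  | Gen.y => Multiplicative.ofAdd (f : ZMod n)

theorem retractionGen_relators {r : ℤ} {n : ℕ} {s f : ℤ} (A : ℤ)
    (h : f * (r - s) ≡ 0 [ZMOD n]) :
    ∀ w ∈ extRelators r n s A, FreeGroup.lift (retractionGen n f) w = 1 := by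
  have h' : (f : ZMod n) * ((r : ZMod n) - s) = 0 := by
    have := (ZMod.intCast_eq_intCast_iff _ _ n).2 h
    push_cast at this
    exact this
  intro w hw
  rcases hw with rfl | rfl
  · simp [retractionGen, ← ofAdd_nsmul]
  · simp only [map_mul, map_zpow, FreeGroup.lift_apply_of, retractionGen, ← ofAdd_zsmul,
      ← ofAdd_add]
    rw [← ofAdd_zero]
    congr 1
    simp only [zsmul_eq_mul]
    push_cast
    linear_combination h'

/-- The retraction `ν^f : E → ⟨t | t^n⟩` with `ν^f(t) = t` and `ν^f(y) = t^f`. -/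
def retraction {r : ℤ} {n : ℕ} {s f : ℤ} (A : ℤ) (h : f * (r - s) ≡ 0 [ZMOD n]) :
    ExtGroup r n s A →* Multiplicative (ZMod n) :=
  PresentedGroup.toGroup (retractionGen_relators A h)

/-- A group is large if a subgroup of finite index surjects onto the free group of rank two. -/
def IsLarge (G : Type*) [Group G] : Prop :=
  ∃ H : Subgroup G, H.FiniteIndex ∧ ∃ φ : H →* FreeGroup (Fin 2), Function.Surjective φ

/-- A group is virtually abelian if it has an abelian subgroup of finite index. -/
def IsVirtuallyAbelian (G : Type*) [Group G] : Prop :=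
  ∃ H : Subgroup G, H.FiniteIndex ∧ ∀ a ∈ H, ∀ b ∈ H, a * b = b * a

end CycPres

/-! Everything reduces to `E`: both `ker ν^f` and `G_n(w)` embed in `E` with finite index. Largeness
passes to such subgroups because powers of the two free generators still do not commute, and virtual
abelianness passes to all subgroups.

For `E`, let `d = gcd(n, A)`, `m = n / d` and `N = |r^m - s^m|`. If `r` and `s` are coprime, the
relation forces `y^N = 1`. When `N ≠ 0`, `E` is morally the amalgam of `ℤ/n` and `ℤ/N ⋊ ℤ/m` over
`ℤ/m`, with indices `d` and `N`. It should therefore be virtually abelian when an index is `1` or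
both are `2`, and large otherwise. If `k = gcd(r, s) ≠ 1`, then `E` maps onto `ℤ/n * ℤ/k`, which is
large unless `n = 1` or `n = k = 2`. The remaining small cases are settled by hand.

Largeness is proved without amalgam theory. `ExtGroup.isLarge_of_function` builds an explicit action
of `E` on `(ℤ/n × M) × F₂`, with `M` finite, from a function `κ` solving `r κ(i + A) = s κ(i)`.
Virtual abelianness comes from `isVirtuallyAbelian_of_normal_zpowers` and
`isVirtuallyAbelian_of_involution`. `ExtGroup.large_or_virtuallyAbelian` assembles the cases. -/

namespace CycPres

/-! ### Largeness and virtual abelianness under finite-index embeddings and quotients. -/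

section Large

variable {G K : Type*} [Group G] [Group K]

theorem not_commute_of_pow {i j : ℕ} (hi : i ≠ 0) (hj : j ≠ 0) :
    ¬ Commute ((FreeGroup.of (0 : Fin 2)) ^ i) (FreeGroup.of (1 : Fin 2) ^ j) := by
  intro h
  -- The generators go to upper and lower unitriangular matrices; the upper-left entries of the two
  -- products differ by `i * j`.
  have h := h.map (FreeGroup.lift
    ![ModularGroup.T, ModularGroup.S * ModularGroup.T * ModularGroup.S⁻¹])
  simp only [map_pow, FreeGroup.lift_apply_of, conj_pow, Matrix.cons_val_zero,
    Matrix.cons_val_one] at h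
  have hT : ∀ k : ℕ, ((ModularGroup.T ^ k : Matrix.SpecialLinearGroup (Fin 2) ℤ) :
      Matrix (Fin 2) (Fin 2) ℤ) = !![1, (k : ℤ); 0, 1] := fun k => by
    rw [← zpow_natCast, ModularGroup.coe_T_zpow]
  have h := congrArg (fun g : Matrix.SpecialLinearGroup (Fin 2) ℤ =>
    (g : Matrix (Fin 2) (Fin 2) ℤ) 0 0) h.eq
  simp only [Matrix.SpecialLinearGroup.coe_mul, hT, ModularGroup.coe_S,
    Matrix.SpecialLinearGroup.coe_inv] at h
  simp [Matrix.mul_apply, Fin.sum_univ_two, Matrix.adjugate_fin_two, hi, hj] at h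

theorem finiteIndex_comap (ψ : K →* G) (H : Subgroup G) [hH : H.FiniteIndex] :
    (H.comap ψ).FiniteIndex := by
  refine ⟨?_⟩
  rw [Subgroup.index_comap]
  exact fun h => hH.index_ne_zero (Subgroup.index_eq_zero_of_relIndex_eq_zero h)

/-- A group with a finite-index subgroup mapping onto a noncommutative subgroup of a free group
is large. -/
theorem isLarge_of_not_commute (H : Subgroup G) [H.FiniteIndex] {F : Type*} [Group F]
    [IsFreeGroup F] (φ : H →* F) {a b : H} (hab : ¬ Commute (φ a) (φ b)) : IsLarge G := by
  -- By Nielsen–Schreier the image is free; being noncommutative it has at least two basis elements,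
  -- so its basis can be collapsed onto two letters.
  obtain ⟨ι, ⟨β⟩⟩ := IsFreeGroup.nonempty_basis (G := φ.range)
  have hι : ∃ i j : ι, i ≠ j := by
    by_contra! hc
    have : Subsingleton ι := ⟨hc⟩
    apply hab
    have hcomm : ∀ x y : FreeGroup ι, Commute x y := by
      rcases isEmpty_or_nonempty ι with h | ⟨⟨i⟩⟩
      · intro x y
        rw [Subsingleton.elim x y]
      · have : Unique ι := ⟨⟨i⟩, fun _ => Subsingleton.elim _ _⟩
        intro x y
        obtain ⟨g, hg⟩ := IsCyclic.exists_generator (α := FreeGroup ι)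
        obtain ⟨k, rfl⟩ := hg x
        obtain ⟨l, rfl⟩ := hg y
        exact (Commute.refl g).zpow_zpow k l
    have h := hcomm (β.repr ⟨φ a, a, rfl⟩) (β.repr ⟨φ b, b, rfl⟩)
    have h' := h.map β.repr.symm
    simp only [MulEquiv.symm_apply_apply] at h'
    exact h'.map φ.range.subtype
  obtain ⟨i, j, hij⟩ := hι
  classical
  let q : FreeGroup ι →* FreeGroup (Fin 2) := FreeGroup.map fun k => if k = i then 0 else 1
  have hq : Function.Surjective q := by
    apply FreeGroup.map_surjective
    intro k
    fin_cases k
    · exact ⟨i, by simp⟩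
    · exact ⟨j, by simp [hij.symm]⟩
  exact ⟨H, inferInstance, (q.comp β.repr.toMonoidHom).comp φ.rangeRestrict,
    (hq.comp β.repr.surjective).comp φ.rangeRestrict_surjective⟩

theorem IsLarge.of_surjective (ψ : G →* K) (hψ : Function.Surjective ψ) (h : IsLarge K) :
    IsLarge G := by
  obtain ⟨H, hH, φ, hφ⟩ := h
  refine ⟨H.comap ψ, ⟨?_⟩, φ.comp (ψ.subgroupComap H), hφ.comp ?_⟩
  · rw [Subgroup.index_comap_of_surjective _ hψ]
    exact hH.index_ne_zero
  · exact MonoidHom.subgroupComap_surjective_of_surjective ψ H hψ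

/-- The restricted map to `F₂` need not stay surjective, but its image contains a positive power of
every element, hence two that do not commute. -/
theorem IsLarge.of_finiteIndex_range (ι : K →* G) [hr : ι.range.FiniteIndex]
    (h : IsLarge G) : IsLarge K := by
  obtain ⟨H, hH, φ, hφ⟩ := h
  have hfi : (H.comap ι).FiniteIndex := finiteIndex_comap ι H
  have key : ∀ x, ∃ k : H.comap ι, ∃ i : ℕ, i ≠ 0 ∧ φ (ι.subgroupComap H k) = x ^ i := by
    intro x
    obtain ⟨g, rfl⟩ := hφ x
    obtain ⟨i, hi, -, k, hk⟩ := Subgroup.exists_pow_mem_of_index_ne_zero hr.index_ne_zero (g : G)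
    have hkH : k ∈ H.comap ι := by
      rw [Subgroup.mem_comap, hk]
      exact H.pow_mem g.2 i
    refine ⟨⟨k, hkH⟩, i, hi.ne', ?_⟩
    rw [← map_pow]
    congr 1
    exact Subtype.ext hk
  obtain ⟨a, i, hi, ha⟩ := key (FreeGroup.of 0)
  obtain ⟨b, j, hj, hb⟩ := key (FreeGroup.of 1)
  refine isLarge_of_not_commute (H.comap ι) (φ.comp (ι.subgroupComap H)) (a := a) (b := b) ?_
  simp only [MonoidHom.comp_apply, ha, hb]
  exact not_commute_of_pow hi hj

theorem IsVirtuallyAbelian.of_injective (ι : K →* G) (hι : Function.Injective ι)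
    (h : IsVirtuallyAbelian G) : IsVirtuallyAbelian K := by
  obtain ⟨H, hH, hc⟩ := h
  refine ⟨H.comap ι, finiteIndex_comap ι H, fun a ha b hb => hι ?_⟩
  rw [map_mul, map_mul]
  exact hc _ ha _ hb

theorem large_or_virtuallyAbelian_of_injective (ι : K →* G) (hι : Function.Injective ι)
    [ι.range.FiniteIndex] (h : IsLarge G ∨ IsVirtuallyAbelian G) :
    IsLarge K ∨ IsVirtuallyAbelian K :=
  h.imp (.of_finiteIndex_range ι) (.of_injective ι hι)

theorem large_or_virtuallyAbelian_of_mulEquiv (e : K ≃* G)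
    (h : IsLarge G ∨ IsVirtuallyAbelian G) : IsLarge K ∨ IsVirtuallyAbelian K :=
  h.imp (.of_surjective e.toMonoidHom e.surjective) (.of_injective e.toMonoidHom e.injective)

end Large

/-! ### Criteria for virtual abelianness of two-generator groups. -/

section FiniteIndex

variable {G : Type*} [Group G]

theorem normal_closure_of_generators {T S : Set G} (hT : Subgroup.closure T = ⊤)
    (h : ∀ x ∈ T, ∀ g ∈ S, x * g * x⁻¹ ∈ Subgroup.closure S ∧ x⁻¹ * g * x ∈ Subgroup.closure S) :
    (Subgroup.closure S).Normal := by
  have conj_mem : ∀ x : G, (∀ g ∈ S, x * g * x⁻¹ ∈ Subgroup.closure S) →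
      ∀ g ∈ Subgroup.closure S, x * g * x⁻¹ ∈ Subgroup.closure S := by
    intro x hx
    have : Subgroup.closure S ≤ (Subgroup.closure S).comap (MulAut.conj x).toMonoidHom := by
      rw [Subgroup.closure_le]
      exact fun g hg => hx g hg
    exact fun g hg => this hg
  rw [← Subgroup.normalizer_eq_top_iff, eq_top_iff, ← hT, Subgroup.closure_le]
  intro x hx
  rw [SetLike.mem_coe, Subgroup.mem_normalizer_iff]
  refine fun g => ⟨conj_mem x (fun g hg => (h x hx g hg).1) g, fun hg => ?_⟩
  have := conj_mem x⁻¹ (fun g hg => by simpa using (h x hx g hg).2) _ hg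
  simpa [mul_assoc] using this

theorem finiteIndex_of_generators {a b : G} (hT : Subgroup.closure {a, b} = ⊤)
    {H : Subgroup G} [H.Normal] (Q : Subgroup (G ⧸ H)) [Finite Q] (ha : (a : G ⧸ H) ∈ Q)
    (hb : (b : G ⧸ H) ∈ Q) : H.FiniteIndex := by
  have hQ : Q = ⊤ := by
    rw [eq_top_iff, ← Subgroup.map_top_of_surjective _ (QuotientGroup.mk'_surjective H), ← hT,
      MonoidHom.map_closure, Subgroup.closure_le]
    rintro _ ⟨x, rfl | rfl, rfl⟩
    · exact ha
    · exact hb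
  have : Finite (G ⧸ H) := by
    rw [← Set.finite_univ_iff, ← Subgroup.coe_top, ← hQ]
    exact Set.toFinite _
  exact Subgroup.finiteIndex_of_finite_quotient

/-- A group generated by `t` and `y` in which `⟨y⟩` is normal and `t` has finite order is virtually
cyclic. -/
theorem isVirtuallyAbelian_of_normal_zpowers {t y : G} (hT : Subgroup.closure {t, y} = ⊤)
    [(Subgroup.zpowers y).Normal] (ht : IsOfFinOrder t) : IsVirtuallyAbelian G := by
  have hfin : IsOfFinOrder (t : G ⧸ Subgroup.zpowers y) :=
    (QuotientGroup.mk' (Subgroup.zpowers y)).isOfFinOrder ht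
  have : Finite (Subgroup.zpowers (t : G ⧸ Subgroup.zpowers y)) := by
    exact hfin.finite_zpowers
  refine ⟨Subgroup.zpowers y, finiteIndex_of_generators hT
    (Subgroup.zpowers (t : G ⧸ Subgroup.zpowers y)) (Subgroup.mem_zpowers _) ?_, ?_⟩
  · rw [(QuotientGroup.eq_one_iff y).2 (Subgroup.mem_zpowers y)]
    exact one_mem _
  · rintro _ ⟨i, rfl⟩ _ ⟨j, rfl⟩
    exact ((Commute.refl y).zpow_zpow i j).eq

/-- A group generated by an involution `a` and an element `b` such that `a` normalizes `⟨b²⟩` is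
virtually abelian. -/
theorem isVirtuallyAbelian_of_involution {a b : G} (hT : Subgroup.closure {a, b} = ⊤)
    (ha : a * a = 1) {e : ℤ} (hz : a * (b * b) * a = (b * b) ^ e) : IsVirtuallyAbelian G := by
  have hai : a⁻¹ = a := inv_eq_of_mul_eq_one_left ha
  set z := b * b with hzdef
  set p := a * b with hp
  -- Modulo the normal subgroup `⟨z⟩` the group is a quotient of the infinite dihedral group, where
  -- `(ab)²` is a translation. Adding it leaves a quotient of the Klein four-group.
  set S : Set G := {p * p, z} with hS
  have hbz : Commute b z := (Commute.refl b).mul_right (Commute.refl b)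
  have haz : ∀ k : ℤ, a * z ^ k * a = z ^ (e * k) := by
    intro k
    have := conj_zpow (a := a) (b := z) (i := k)
    rw [hai, hz, ← zpow_mul] at this
    exact this.symm
  have hee : z ^ (e * e) = z := by
    rw [← haz, ← hz]
    calc a * (a * z * a) * a = (a * a) * z * (a * a) := by group
      _ = z := by rw [ha]; simp
  have hpz : p⁻¹ * z * p = z ^ e := by
    calc p⁻¹ * z * p = b⁻¹ * (a⁻¹ * z * a) * b := by rw [hp]; group
      _ = b⁻¹ * (z ^ e * b) := by rw [hai, hz, mul_assoc]
      _ = z ^ e := by rw [← (hbz.zpow_right e).eq]; group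
  have hpz' : ∀ k : ℤ, p⁻¹ * z ^ k * p = z ^ (e * k) := by
    intro k
    have := conj_zpow (a := p⁻¹) (b := z) (i := k)
    rw [inv_inv, hpz, ← zpow_mul] at this
    exact this.symm
  have hpp : Commute (p * p) z := by
    have : (p * p)⁻¹ * z * (p * p) = z := by
      calc (p * p)⁻¹ * z * (p * p) = p⁻¹ * (p⁻¹ * z * p) * p := by group
        _ = z := by rw [hpz, hpz', hee]
    have h2 : z * (p * p) = p * p * z := by
      rw [mul_assoc, inv_mul_eq_iff_eq_mul] at this
      exact this
    exact h2.symm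
  have hap : a * p * a⁻¹ = z * p⁻¹ := by
    calc a * p * a⁻¹ = (a * a) * b * a⁻¹ := by rw [hp]; group
      _ = z * p⁻¹ := by rw [ha, hp, hzdef]; group
  have hbp : b * p * b⁻¹ = z * p⁻¹ := by
    rw [hp, hzdef, mul_inv_rev, hai]; group
  have hbp' : b⁻¹ * p * b = p⁻¹ * z := by
    rw [hp, hzdef, mul_inv_rev, hai]; group
  have hSz : z ∈ Subgroup.closure S := Subgroup.subset_closure (by simp [hS])
  have hSp : p * p ∈ Subgroup.closure S := Subgroup.subset_closure (by simp [hS])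
  have hzp : z * p⁻¹ * (z * p⁻¹) ∈ Subgroup.closure S := by
    have : z * p⁻¹ * (z * p⁻¹) = z * (p⁻¹ * z * p) * (p * p)⁻¹ := by group
    rw [this, hpz]
    exact mul_mem (mul_mem hSz (zpow_mem hSz e)) (inv_mem hSp)
  have hpz2 : p⁻¹ * z * (p⁻¹ * z) ∈ Subgroup.closure S := by
    have : p⁻¹ * z * (p⁻¹ * z) = (p⁻¹ * z * p) * (p * p)⁻¹ * z := by group
    rw [this, hpz]
    exact mul_mem (mul_mem (zpow_mem hSz e) (inv_mem hSp)) hSz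
  have hnorm : (Subgroup.closure S).Normal := by
    refine normal_closure_of_generators hT ?_
    have hsq : ∀ x : G, x * (p * p) * x⁻¹ = x * p * x⁻¹ * (x * p * x⁻¹) := fun x => by group
    have hsq' : ∀ x : G, x⁻¹ * (p * p) * x = x⁻¹ * p * x * (x⁻¹ * p * x) := fun x => by group
    have h1 : a * (p * p) * a⁻¹ ∈ Subgroup.closure S := by rwa [hsq, hap]
    have h2 : a * z * a⁻¹ ∈ Subgroup.closure S := by
      rw [hai, hz]
      exact zpow_mem hSz e
    rintro x (rfl | rfl) g (rfl | rfl)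
    · exact ⟨h1, by rwa [hai] at h1 ⊢⟩
    · exact ⟨h2, by rwa [hai] at h2 ⊢⟩
    · exact ⟨by rwa [hsq, hbp], by rwa [hsq', hbp']⟩
    · refine ⟨?_, ?_⟩
      · rwa [hbz.eq, mul_inv_cancel_right]
      · rwa [mul_assoc, ← hbz.eq, inv_mul_cancel_left]
  refine ⟨Subgroup.closure S, ?_, ?_⟩
  · set A : G ⧸ Subgroup.closure S := (a : G ⧸ Subgroup.closure S) with hA
    set B : G ⧸ Subgroup.closure S := (b : G ⧸ Subgroup.closure S) with hB
    have hAA : A * A = 1 := by rw [hA, ← QuotientGroup.mk_mul, ha, QuotientGroup.mk_one]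
    have hBB : B * B = 1 := by
      rw [hB, ← QuotientGroup.mk_mul]
      exact (QuotientGroup.eq_one_iff _).2 hSz
    have hAB : A * B * (A * B) = 1 := by
      rw [hA, hB, ← QuotientGroup.mk_mul, ← QuotientGroup.mk_mul]
      exact (QuotientGroup.eq_one_iff _).2 hSp
    have hAi : A⁻¹ = A := inv_eq_of_mul_eq_one_left hAA
    have hBi : B⁻¹ = B := inv_eq_of_mul_eq_one_left hBB
    have hBA : B * A = A * B := by
      rw [← inv_eq_of_mul_eq_one_left hAB, mul_inv_rev, hAi, hBi]
    have hAA' : ∀ x, A * (A * x) = x := fun x => by rw [← mul_assoc, hAA, one_mul]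
    have hBA' : ∀ x, B * (A * x) = A * (B * x) := fun x => by rw [← mul_assoc, hBA, mul_assoc]
    let Q : Subgroup (G ⧸ Subgroup.closure S) :=
      { carrier := {1, A, B, A * B}
        one_mem' := by simp
        mul_mem' := by
          rintro _ _ (rfl | rfl | rfl | rfl) (rfl | rfl | rfl | rfl) <;>
            simp [mul_assoc, hAA, hBB, hBA, hAA', hBA']
        inv_mem' := by
          rintro _ (rfl | rfl | rfl | rfl) <;> simp [hAi, hBi, hBA] }
    have : Finite Q := Set.Finite.to_subtype (s := {1, A, B, A * B}) (Set.toFinite _)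
    exact finiteIndex_of_generators hT Q (by simp [Q, ← hA, ← Subgroup.mem_carrier])
      (by simp [Q, ← hB, ← Subgroup.mem_carrier])
  · intro x hx y hy
    have hcomm : ∀ x ∈ S, ∀ y ∈ S, x * y = y * x := by
      rintro x (rfl | rfl) y (rfl | rfl)
      · rfl
      · exact hpp.eq
      · exact hpp.symm.eq
      · rfl
    have := Subgroup.isMulCommutative_closure hcomm
    exact setLike_mul_comm hx hy

end FiniteIndex

/-! ### Largeness from actions on finite sets with free-group fibres. -/

/-- A group is large if it acts on `X × F₂` with `X` finite, compatibly with right multiplication on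
`F₂`, such that two elements move the point `(x, 1)` to `(x, g)` for `g` running over the free
generators. -/
theorem isLarge_of_equivariant_action {E X : Type*} [Group E] [Finite X]
    (ρ : E →* Equiv.Perm (X × FreeGroup (Fin 2)))
    (hρ : ∀ e x g h, ρ e (x, g * h) = ((ρ e (x, g)).1, (ρ e (x, g)).2 * h)) (x₀ : X)
    (hgen : ∀ k, ∃ e, ρ e (x₀, 1) = (x₀, FreeGroup.of k)) : IsLarge E := by
  have hρ' : ∀ e x g, ρ e (x, g) = ((ρ e (x, 1)).1, (ρ e (x, 1)).2 * g) := fun e x g => by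
    simpa using hρ e x 1 g
  let _ : MulAction E X :=
    { smul := fun e x => (ρ e (x, 1)).1
      one_smul := fun x => by
        change (ρ 1 (x, 1)).1 = x
        simp
      mul_smul := fun e e' x => by
        change (ρ (e * e') (x, 1)).1 = (ρ e ((ρ e' (x, 1)).1, 1)).1
        rw [map_mul, Equiv.Perm.mul_apply, hρ' e (ρ e' (x, 1)).1 (ρ e' (x, 1)).2] }
  have hmem : ∀ e : MulAction.stabilizer E x₀, (ρ e (x₀, 1)).1 = x₀ := fun e => e.2
  -- The stabilizer preserves the fibre over `x₀`; commuting with right multiplication, it acts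
  -- there by left multiplications.
  let φ : MulAction.stabilizer E x₀ →* FreeGroup (Fin 2) := MonoidHom.mk'
    (fun e => (ρ e (x₀, 1)).2) (fun e e' => by
      have h : ρ (e' : E) (x₀, 1) = (x₀, (ρ (e' : E) (x₀, 1)).2) := Prod.ext (hmem e') rfl
      rw [Subgroup.coe_mul, map_mul, Equiv.Perm.mul_apply, h, hρ'])
  have : Finite (E ⧸ MulAction.stabilizer E x₀) :=
    Finite.of_equiv _ (MulAction.orbitEquivQuotientStabilizer E x₀)
  refine ⟨MulAction.stabilizer E x₀, Subgroup.finiteIndex_of_finite_quotient, φ, ?_⟩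
  rw [← MonoidHom.range_eq_top, eq_top_iff, ← FreeGroup.closure_range_of, Subgroup.closure_le]
  rintro _ ⟨k, rfl⟩
  obtain ⟨e, he⟩ := hgen k
  exact ⟨⟨e, congrArg Prod.fst he⟩, congrArg Prod.snd he⟩

/-! ### Generators, relations and universal property of `E`. -/

namespace ExtGroup

variable {r : ℤ} {n : ℕ} {s A : ℤ}

/-- The generator `t`. -/
def t : ExtGroup r n s A := PresentedGroup.of Gen.t

/-- The generator `y`. -/
def y : ExtGroup r n s A := PresentedGroup.of Gen.y

theorem t_pow : (t : ExtGroup r n s A) ^ n = 1 :=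
  PresentedGroup.one_of_mem (rels := extRelators r n s A) (Or.inl rfl)

theorem relation : (y : ExtGroup r n s A) ^ r * t ^ A * y ^ (-s) * t ^ (-A) = 1 :=
  PresentedGroup.one_of_mem (rels := extRelators r n s A) (Or.inr rfl)

theorem closure_t_y : Subgroup.closure {(t : ExtGroup r n s A), y} = ⊤ := by
  rw [← PresentedGroup.closure_range_of (extRelators r n s A)]
  congr 1
  ext x
  constructor
  · rintro (rfl | rfl)
    exacts [⟨_, rfl⟩, ⟨_, rfl⟩]
  · rintro ⟨_ | _, rfl⟩
    exacts [Or.inl rfl, Or.inr rfl]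

section Lift

variable {G : Type*} [Group G] (a b : G) (ha : a ^ n = 1)
  (hb : b ^ r * a ^ A * b ^ (-s) * a ^ (-A) = 1)

/-- The homomorphism with `t ↦ a` and `y ↦ b`. -/
def lift : ExtGroup r n s A →* G :=
  PresentedGroup.toGroup (f := fun | Gen.t => a | Gen.y => b) (by
    rintro _ (rfl | rfl)
    · simpa using ha
    · simpa using hb)

@[simp]
theorem lift_t : lift a b ha hb t = a := PresentedGroup.toGroup.of _

@[simp]
theorem lift_y : lift a b ha hb y = b := PresentedGroup.toGroup.of _

end Lift

theorem surjective_of_mem_range {G : Type*} [Group G] (φ : G →* ExtGroup r n s A)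
    (ht : t ∈ φ.range) (hy : y ∈ φ.range) : Function.Surjective φ := by
  rw [← MonoidHom.range_eq_top, eq_top_iff, ← closure_t_y, Subgroup.closure_le]
  rintro _ (rfl | rfl)
  exacts [ht, hy]

end ExtGroup

theorem zpow_eq_of_map_add {G : Type*} [Group G] (f : ℤ → G) (h : ∀ a b, f (a + b) = f a * f b)
    (k : ℤ) : f 1 ^ k = f k := by
  let φ : Multiplicative ℤ →* G := MonoidHom.mk' (fun a => f a.toAdd) fun a b => h _ _
  have : φ (Multiplicative.ofAdd 1 ^ k) = φ (Multiplicative.ofAdd 1) ^ k := map_zpow φ _ _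
  rw [← ofAdd_zsmul, smul_eq_mul, mul_one] at this
  exact this.symm

/-! ### The permutation action of `E` attached to `κ`. -/

section Action

variable {n : ℕ} {M : Type*} [AddCommGroup M]

/-- Translation of the first coordinate by `k`. -/
def rotation (n : ℕ) (M F : Type*) (k : ℤ) : Equiv.Perm ((ZMod n × M) × F) where
  toFun x := ((x.1.1 + k, x.1.2), x.2)
  invFun x := ((x.1.1 - k, x.1.2), x.2)
  left_inv _ := by simp
  right_inv _ := by simp

/-- The `k`-th iterate of translation of the second coordinate by `κ`, conjugated by left
multiplication by `ℓ` on the third. -/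
def twist {F : Type*} [Group F] (κ : ZMod n → M) (ℓ : ZMod n → M → F) (k : ℤ) :
    Equiv.Perm ((ZMod n × M) × F) where
  toFun x := ((x.1.1, x.1.2 + k • κ x.1.1),
    (ℓ x.1.1 (x.1.2 + k • κ x.1.1))⁻¹ * ℓ x.1.1 x.1.2 * x.2)
  invFun x := ((x.1.1, x.1.2 - k • κ x.1.1),
    (ℓ x.1.1 (x.1.2 - k • κ x.1.1))⁻¹ * ℓ x.1.1 x.1.2 * x.2)
  left_inv _ := by simp [mul_assoc]
  right_inv _ := by simp [mul_assoc]

theorem rotation_one_zpow (M F : Type*) (k : ℤ) : rotation n M F 1 ^ k = rotation n M F k := by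
  refine zpow_eq_of_map_add _ (fun a b => ?_) k
  ext x <;> simp [rotation, Equiv.Perm.mul_apply]
  ring

theorem twist_one_zpow {F : Type*} [Group F] (κ : ZMod n → M) (ℓ : ZMod n → M → F) (k : ℤ) :
    twist κ ℓ 1 ^ k = twist κ ℓ k := by
  refine zpow_eq_of_map_add _ (fun a b => ?_) k
  have h : ∀ (i : ZMod n) (j : M), j + (a + b) • κ i = j + b • κ i + a • κ i := fun i j => by
    rw [add_smul]; abel
  ext x
  · simp [twist, Equiv.Perm.mul_apply]
  · simp [twist, Equiv.Perm.mul_apply, h]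
  · simp [twist, Equiv.Perm.mul_apply, h, mul_assoc]

variable {r s A : ℤ}

/-- Largeness of `E(r, n, s, A)` from a function `κ : ℤ/n → M` to a finite abelian group with
`r κ(i + A) = s κ(i)`. -/
theorem ExtGroup.isLarge_of_function [NeZero n] [Finite M] (κ : ZMod n → M)
    (hκ : ∀ i, r • κ (i + A) = s • κ i) {d : ℕ} (hd : d ∣ n) (hA : (d : ℤ) ∣ A) {e : M}
    (h0 : κ 0 = e) (q p : Fin 2 → ℕ) (hκq : ∀ k, κ (q k) = e) (hq : ∀ k, (q k : ZMod d) ≠ 0)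
    (hp : ∀ k, p k • e ≠ 0) (hne : (q 0 : ZMod d) ≠ q 1 ∨ p 0 • e ≠ p 1 • e) :
    IsLarge (ExtGroup r n s A) := by
  classical
  let c := ZMod.castHom hd (ZMod d)
  -- The points `(q k, p k • e)` are labelled by the free generators. The label depends on `i` only
  -- modulo `d`, so it is invariant under `t ^ A`; thus conjugating `y` by it while leaving `t`
  -- alone preserves the relation.
  let ℓ : ZMod n → M → FreeGroup (Fin 2) := fun i j =>
    if c i = q 0 ∧ j = p 0 • e then .of 0 else if c i = q 1 ∧ j = p 1 • e then .of 1 else 1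
  have hcA : c (A : ZMod n) = 0 := by
    rw [map_intCast]
    exact (ZMod.intCast_zmod_eq_zero_iff_dvd A d).2 hA
  have hℓA : ∀ i j, ℓ (i + A) j = ℓ i j := fun i j => by
    simp only [ℓ, map_add, hcA, add_zero]
  have hℓ0 : ∀ j, ℓ 0 j = 1 := fun j => by
    simp [ℓ, (hq _).symm]
  have hℓ0' : ∀ i, ℓ i 0 = 1 := fun i => by
    simp [ℓ, (hp _).symm]
  have hℓk : ∀ k, ℓ (q k) (p k • e) = .of k := by
    intro k
    fin_cases k
    · simp [ℓ]
    · have : ¬ ((q 1 : ZMod d) = q 0 ∧ p 1 • e = p 0 • e) := by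
        rintro ⟨h1, h2⟩
        exact hne.elim (fun h => h h1.symm) (fun h => h h2.symm)
      simp [ℓ, this]
  let F := FreeGroup (Fin 2)
  let T := rotation n M F 1
  let Y := twist κ ℓ 1
  have hTn : T ^ n = 1 := by
    rw [← zpow_natCast, rotation_one_zpow]
    ext x <;> simp [rotation]
  have hrel : Y ^ r * T ^ A * Y ^ (-s) * T ^ (-A) = 1 := by
    rw [rotation_one_zpow, rotation_one_zpow, twist_one_zpow, twist_one_zpow]
    have hκ' : ∀ i, r • κ i = s • κ (i + -A) := fun i => by
      rw [← hκ, neg_add_cancel_right]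
    have hℓ' : ∀ i j, ℓ (i + -A) j = ℓ i j := fun i j => by
      rw [← hℓA, neg_add_cancel_right]
    ext x
    · simp [rotation, twist, Equiv.Perm.mul_apply]
    · simp [rotation, twist, Equiv.Perm.mul_apply, hκ']
    · simp [rotation, twist, Equiv.Perm.mul_apply, hκ', hℓ', mul_assoc]
  let ρ := ExtGroup.lift T Y hTn hrel
  refine isLarge_of_equivariant_action ρ ?_ (0, 0) ?_
  · let Z : Subgroup (Equiv.Perm ((ZMod n × M) × F)) :=
      { carrier := {σ | ∀ x g h, σ (x, g * h) = ((σ (x, g)).1, (σ (x, g)).2 * h)}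
        one_mem' := by intro x g h; rfl
        mul_mem' := by
          intro σ τ hσ hτ x g h
          rw [Equiv.Perm.mul_apply, hτ, hσ]
          rfl
        inv_mem' := by
          intro σ hσ x g h
          rw [Equiv.Perm.inv_eq_iff_eq, hσ]
          simp }
    suffices h : (⊤ : Subgroup (ExtGroup r n s A)) ≤ Z.comap ρ from
      fun e => h (Subgroup.mem_top e)
    rw [← ExtGroup.closure_t_y, Subgroup.closure_le]
    rintro _ (rfl | rfl)
    · change ρ ExtGroup.t ∈ Z
      rw [ExtGroup.lift_t]
      intro x g h
      rfl
    · change ρ ExtGroup.y ∈ Z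
      rw [ExtGroup.lift_y]
      intro x g h
      simp [Y, twist, mul_assoc]
  · intro k
    -- Acting from the right, the base point moves `(0, 0) → (0, p e) → (q, p e) → (q, 0) → (0, 0)`.
    -- Among the labels met, only the one at `(q, p e)` is nontrivial, and it contributes the free
    -- generator.
    refine ⟨ExtGroup.t ^ (-(q k : ℤ)) * ExtGroup.y ^ (-(p k : ℤ)) * ExtGroup.t ^ (q k : ℤ) *
      ExtGroup.y ^ (p k : ℤ), ?_⟩
    rw [map_mul, map_mul, map_mul, map_zpow, map_zpow, map_zpow, map_zpow, ExtGroup.lift_t,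
      ExtGroup.lift_y, rotation_one_zpow, rotation_one_zpow, twist_one_zpow, twist_one_zpow]
    simp [rotation, twist, Equiv.Perm.mul_apply, h0, hκq, hℓ0, hℓ0', hℓk]

end Action

/-! ### Choices of `κ` that make `E` large. -/

theorem natCast_zmod_ne_natCast {n a b : ℕ} (hab : a < b) (hb : b < n) :
    (a : ZMod n) ≠ (b : ZMod n) := by
  rw [Ne, ZMod.natCast_eq_natCast_iff', Nat.mod_eq_of_lt hb, Nat.mod_eq_of_lt (hab.trans hb)]
  exact hab.ne

/-- The case of `isLarge_of_function` in which `κ` takes the value `1` on small arguments. -/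
theorem ExtGroup.isLarge_of_function_eq_one {n N d : ℕ} [NeZero n] [NeZero N] {r s A : ℤ}
    (κ : ZMod n → ZMod N) (hκ : ∀ i, r • κ (i + A) = s • κ i) (hd : d ∣ n) (hA : (d : ℤ) ∣ A)
    (hone : ∀ j : ℕ, j < d → κ j = 1) (hd2 : 2 ≤ d) (hN2 : 2 ≤ N) (h3 : 3 ≤ d ∨ 3 ≤ N) :
    IsLarge (ExtGroup r n s A) := by
  have h0 : κ 0 = 1 := by simpa using hone 0 (by omega)
  have hd1 : ((1 : ℕ) : ZMod d) ≠ 0 := by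
    simpa using (natCast_zmod_ne_natCast (n := d) zero_lt_one (by omega)).symm
  have hN1 : ((1 : ℕ) : ZMod N) ≠ 0 := by
    simpa using (natCast_zmod_ne_natCast (n := N) zero_lt_one (by omega)).symm
  rcases h3 with h3 | h3
  -- With `d ≥ 3` there are two nonzero positions modulo `d`; otherwise `N ≥ 3` provides two nonzero
  -- heights over a single position.
  · refine isLarge_of_function κ hκ hd hA h0 ![1, 2] ![1, 1] ?_ ?_ ?_ (Or.inl ?_)
    · intro k
      fin_cases k
      exacts [hone 1 (by omega), hone 2 (by omega)]
    · intro k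
      fin_cases k
      · exact hd1
      · simpa using (natCast_zmod_ne_natCast (n := d) zero_lt_two (by omega)).symm
    · intro k
      fin_cases k <;> simpa using hN1
    · exact natCast_zmod_ne_natCast (a := 1) (b := 2) (by norm_num) (by omega)
  · refine isLarge_of_function κ hκ hd hA h0 ![1, 1] ![1, 2] ?_ ?_ ?_ (Or.inr ?_)
    · intro k
      fin_cases k <;> exact hone 1 (by omega)
    · intro k
      fin_cases k <;> exact hd1
    · intro k
      fin_cases k
      · simpa using hN1
      · simpa using (natCast_zmod_ne_natCast (n := N) zero_lt_two (by omega)).symm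
    · simpa using natCast_zmod_ne_natCast (n := N) one_lt_two (by omega)

/-- `E(r, n, s, A)` maps onto the free product of cyclic groups of orders `n` and `k`. -/
theorem ExtGroup.isLarge_of_common_divisor {n k : ℕ} {r s A : ℤ} (hr : (k : ℤ) ∣ r)
    (hs : (k : ℤ) ∣ s) (hn : 2 ≤ n) (hk : 2 ≤ k) (h3 : 3 ≤ n ∨ 3 ≤ k) :
    IsLarge (ExtGroup r n s A) := by
  have : NeZero n := ⟨by omega⟩
  have : NeZero k := ⟨by omega⟩
  have hy : ∀ l : ℤ, (k : ℤ) ∣ l → (y : ExtGroup k n 0 0) ^ l = 1 := by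
    rintro _ ⟨l, rfl⟩
    rw [zpow_mul]
    simpa using congrArg (· ^ l) (relation (r := k) (n := n) (s := 0) (A := 0))
  refine IsLarge.of_surjective (K := ExtGroup k n 0 0)
    (lift t y t_pow (by rw [hy r hr, hy (-s) (by simpa using hs)]; simp))
    (surjective_of_mem_range _ ⟨t, by simp⟩ ⟨y, by simp⟩) ?_
  exact isLarge_of_function_eq_one (N := k) (fun _ => 1) (by simp) dvd_rfl (by simp) (by simp)
    hn hk h3

/-- Take `k(i) = b ⌊i / d⌋` with `b` inverse to `A'` modulo `m`: adding `A = d A'` raises the floor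
by `A'`. This serves as an exponent in the geometric solution for `κ`. -/
theorem exists_shift_equivariant {n d m : ℕ} [NeZero n] (hn : n = d * m) {A A' : ℤ}
    (hA : A = d * A') (hA' : IsCoprime A' (m : ℤ)) :
    ∃ k : ZMod n → ZMod m, (∀ i, k (i + A) = k i + 1) ∧ ∀ j : ℕ, j < d → k j = 0 := by
  obtain ⟨b, c, hbc⟩ := hA'
  have hb : (b : ZMod m) * A' = 1 := by
    have := congrArg (fun x : ℤ => (x : ZMod m)) hbc
    push_cast at this
    simpa using this
  have hd : d ≠ 0 := by
    rintro rfl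
    exact NeZero.ne n (by simpa using hn)
  have hm : m ≠ 0 := by
    rintro rfl
    exact NeZero.ne n (by simpa using hn)
  refine ⟨fun i => b * ((i.val / d : ℕ) : ZMod m), fun i => ?_, fun j hj => ?_⟩
  · have h1 : (((i + A).val : ℤ) : ZMod n) = ((i.val + A : ℤ) : ZMod n) := by
      push_cast
      simp
    rw [ZMod.intCast_eq_intCast_iff_dvd_sub] at h1
    obtain ⟨l, hl⟩ := h1
    -- Reducing modulo `n = d m` changes the floor by a multiple of `m`.
    have h2 : (((i + A).val / d : ℕ) : ℤ) = ((i.val / d : ℕ) : ℤ) + (A' - m * l) := by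
      have : ((i + A).val : ℤ) = i.val + d * (A' - m * l) := by
        have hn' : (n : ℤ) = d * m := by exact_mod_cast hn
        linear_combination hA - hl - l * hn'
      rw [Int.natCast_div, this, Int.add_mul_ediv_left _ _ (by exact_mod_cast hd), Int.natCast_div]
    have h3 := congrArg (fun x : ℤ => (x : ZMod m)) h2
    simp only [Int.cast_add, Int.cast_sub, Int.cast_mul, Int.cast_natCast, ZMod.natCast_self,
      zero_mul, sub_zero] at h3
    simp only [h3]
    rw [← hb]
    ring
  · have : j < n := hj.trans_le (by rw [hn]; exact Nat.le_mul_of_pos_right d (by omega))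
    simp [ZMod.val_natCast, Nat.mod_eq_of_lt this, Nat.div_eq_of_lt hj]

/-- The amalgam case, with `m` the order of `t ^ A`: here `N` is a divisor of `r ^ m - s ^ m` prime
to `r`. -/
theorem ExtGroup.isLarge_of_coprime {n d m N : ℕ} [NeZero n] (hn : n = d * m) {r s A A' : ℤ}
    (hA : A = d * A') (hA' : IsCoprime A' (m : ℤ)) (hrN : IsCoprime r (N : ℤ))
    (hN : (N : ℤ) ∣ r ^ m - s ^ m) (hd2 : 2 ≤ d) (hN2 : 2 ≤ N) (h3 : 3 ≤ d ∨ 3 ≤ N) :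
    IsLarge (ExtGroup r n s A) := by
  have : NeZero N := ⟨by omega⟩
  have : NeZero m := ⟨by rintro rfl; exact NeZero.ne n (by simpa using hn)⟩
  obtain ⟨k, hk, hk0⟩ := exists_shift_equivariant hn hA hA'
  obtain ⟨b, c', hbc⟩ := hrN
  have hb : (b : ZMod N) * r = 1 := by
    have := congrArg (fun x : ℤ => (x : ZMod N)) hbc
    push_cast at this
    simpa using this
  have hrs : (r : ZMod N) ^ m = (s : ZMod N) ^ m := by
    have := (ZMod.intCast_zmod_eq_zero_iff_dvd _ N).2 hN
    push_cast at this
    exact sub_eq_zero.1 this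
  -- Here `c = s / r`, so `κ = c ^ k` solves the equation; `c ^ m = 1` makes exponents modulo `m`
  -- legitimate.
  set c : ZMod N := b * s with hc
  have hcm : c ^ m = 1 := by
    rw [hc, mul_pow, ← hrs, ← mul_pow, hb, one_pow]
  have hpow : ∀ x : ZMod m, c ^ (x + 1).val = c * c ^ x.val := by
    intro x
    have h : (((x + 1).val : ℕ) : ZMod m) = ((x.val + 1 : ℕ) : ZMod m) := by
      push_cast
      simp
    rw [ZMod.natCast_eq_natCast_iff'] at h
    rw [← pow_succ', pow_eq_pow_mod _ hcm, h, ← pow_eq_pow_mod _ hcm]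
  refine isLarge_of_function_eq_one (N := N) (d := d) (fun i => c ^ (k i).val) (fun i => ?_)
    ⟨m, hn⟩ ⟨A', hA⟩ (fun j hj => ?_) hd2 hN2 h3
  · rw [hk, hpow, zsmul_eq_mul, zsmul_eq_mul, hc]
    linear_combination (s : ZMod N) * (b * s : ZMod N) ^ (k i).val * hb
  · simp [hk0 j hj]

theorem isCoprime_pow_sub_pow {r s : ℤ} (h : IsCoprime r s) {m : ℕ} (hm : m ≠ 0) :
    IsCoprime r (r ^ m - s ^ m) := by
  obtain ⟨k, rfl⟩ := Nat.exists_eq_succ_of_ne_zero hm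
  rw [pow_succ' r, sub_eq_add_neg, add_comm, IsCoprime.add_mul_left_right_iff,
    IsCoprime.neg_right_iff]
  exact h.pow_right

/-! ### Consequences of `b ^ r * u = u * b ^ s`. -/

section Relation

variable {G : Type*} [Group G] {u b : G} {r s : ℤ}

theorem zpow_pow_mul (h : b ^ r * u = u * b ^ s) (k : ℕ) :
    b ^ (r ^ k) * u ^ k = u ^ k * b ^ (s ^ k) := by
  induction k with
  | zero => simp
  | succ k ih =>
    have h' : ∀ j : ℤ, b ^ (r * j) * u = u * b ^ (s * j) := fun j => by
      have h1 : b ^ r = u * b ^ s * u⁻¹ := eq_mul_inv_of_mul_eq h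
      rw [zpow_mul, h1, conj_zpow, ← zpow_mul]
      group
    have ih' : b ^ (r ^ k * s) * u ^ k = u ^ k * b ^ (s ^ k * s) := by
      have h1 : b ^ (r ^ k) = u ^ k * b ^ (s ^ k) * (u ^ k)⁻¹ := eq_mul_inv_of_mul_eq ih
      rw [zpow_mul, h1, conj_zpow, ← zpow_mul, inv_mul_cancel_right]
    rw [pow_succ' r k, pow_succ' u k, ← mul_assoc, h', mul_assoc, mul_comm s (r ^ k), ih',
      ← mul_assoc, pow_succ]

theorem zpow_sub_eq_one (h : b ^ r * u = u * b ^ s) {m : ℕ} (hu : u ^ m = 1) :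
    b ^ (r ^ m - s ^ m) = 1 := by
  have := zpow_pow_mul h m
  rw [hu, mul_one, one_mul] at this
  rw [zpow_sub, this, mul_inv_cancel]

/-- Since `s` is invertible modulo `N`, `b` is a power of `b ^ s`, whose conjugate by `u` is `b ^
r`. -/
theorem conj_mem_zpowers (h : b ^ r * u = u * b ^ s) {N : ℤ} (hb : b ^ N = 1)
    (hs : IsCoprime s N) : u * b * u⁻¹ ∈ Subgroup.zpowers b := by
  obtain ⟨i, j, hij⟩ := hs
  have h1 : u * b ^ s * u⁻¹ = b ^ r := by rw [← h, mul_inv_cancel_right]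
  have h2 : b = (b ^ s) ^ i := by
    rw [← zpow_mul, ← zpow_one b, ← zpow_mul, one_mul, ← hij, zpow_add, mul_comm j, zpow_mul b N,
      hb, one_zpow, mul_one, mul_comm]
  refine ⟨r * i, ?_⟩
  simp only
  rw [zpow_mul, ← h1, conj_zpow, ← h2]

end Relation

/-! ### The dichotomy for `E`. -/

namespace ExtGroup

variable {r : ℤ} {n : ℕ} {s A : ℤ}

theorem relation_mul : (y : ExtGroup r n s A) ^ r * t ^ A = t ^ A * y ^ s := by
  have h := relation (r := r) (n := n) (s := s) (A := A)
  rw [zpow_neg, zpow_neg, mul_inv_eq_one, mul_inv_eq_iff_eq_mul] at h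
  exact h

theorem isOfFinOrder_t (hn : 0 < n) : IsOfFinOrder (t : ExtGroup r n s A) :=
  isOfFinOrder_iff_pow_eq_one.2 ⟨n, hn, t_pow⟩

theorem t_zpow_mem {k : ℤ} (hk : (Int.gcd n A : ℤ) ∣ k) :
    (t : ExtGroup r n s A) ^ k ∈ Subgroup.zpowers ((t : ExtGroup r n s A) ^ A) := by
  obtain ⟨l, rfl⟩ := hk
  refine ⟨Int.gcdB n A * l, ?_⟩
  simp only
  rw [← zpow_mul, Int.gcd_eq_gcd_ab, add_mul, zpow_add, mul_assoc,
    zpow_mul _ (n : ℤ), zpow_natCast, t_pow, one_zpow, one_mul, mul_assoc]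

theorem isVirtuallyAbelian_of_normalizes (hn : 0 < n)
    (h1 : (t : ExtGroup r n s A) ∈ Subgroup.normalizer (Subgroup.zpowers (y : ExtGroup r n s A))) :
    IsVirtuallyAbelian (ExtGroup r n s A) := by
  have : (Subgroup.zpowers (y : ExtGroup r n s A)).Normal := by
    rw [← Subgroup.normalizer_eq_top_iff, eq_top_iff, ← closure_t_y, Subgroup.closure_le]
    rintro _ (rfl | rfl)
    · exact h1
    · exact Subgroup.le_normalizer (Subgroup.mem_zpowers _)
  exact isVirtuallyAbelian_of_normal_zpowers closure_t_y (isOfFinOrder_t hn)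

/-- Both `r` and `s` are coprime to `r ^ n - s ^ n`, which kills `y`, so `t ^ A` and its inverse
conjugate `⟨y⟩` into itself. As `t` is a power of `t ^ A`, `⟨y⟩` is normal. -/
theorem isVirtuallyAbelian_of_gcd_eq_one (hn : 0 < n) (hA : Int.gcd n A = 1)
    (hrs : IsCoprime r s) : IsVirtuallyAbelian (ExtGroup r n s A) := by
  refine isVirtuallyAbelian_of_normalizes hn ?_
  have hu : ((t : ExtGroup r n s A) ^ A) ^ n = 1 := by
    rw [← zpow_natCast, ← zpow_mul, mul_comm, zpow_mul, zpow_natCast, t_pow, one_zpow]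
  have hN := zpow_sub_eq_one relation_mul hu
  have hrN : IsCoprime r (r ^ n - s ^ n) :=
    isCoprime_pow_sub_pow hrs hn.ne'
  have hsN : IsCoprime s (r ^ n - s ^ n) := by
    rw [← neg_sub, IsCoprime.neg_right_iff]
    exact isCoprime_pow_sub_pow hrs.symm hn.ne'
  have h1 := conj_mem_zpowers relation_mul hN hsN
  have h2 : (t ^ A)⁻¹ * y * (t ^ A)⁻¹⁻¹ ∈ Subgroup.zpowers (y : ExtGroup r n s A) := by
    refine conj_mem_zpowers (r := s) (s := r) ?_ hN hrN
    rw [eq_inv_mul_iff_mul_eq, ← mul_assoc, ← relation_mul, mul_inv_cancel_right]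
  have hnorm : (t : ExtGroup r n s A) ^ A ∈
      Subgroup.normalizer (Subgroup.zpowers (y : ExtGroup r n s A)) := by
    have hconj : ∀ v : ExtGroup r n s A, v * y * v⁻¹ ∈ Subgroup.zpowers (y : ExtGroup r n s A) →
        ∀ g ∈ Subgroup.zpowers (y : ExtGroup r n s A),
          v * g * v⁻¹ ∈ Subgroup.zpowers (y : ExtGroup r n s A) := by
      rintro v hv _ ⟨k, rfl⟩
      simp only
      rw [← conj_zpow]
      exact zpow_mem hv k
    rw [Subgroup.mem_normalizer_iff]
    refine fun g => ⟨hconj _ h1 g, fun hg => ?_⟩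
    simpa [mul_assoc] using hconj _ h2 _ hg
  have ht : (t : ExtGroup r n s A) ∈ Subgroup.zpowers ((t : ExtGroup r n s A) ^ A) := by
    simpa using t_zpow_mem (r := r) (n := n) (s := s) (A := A) (k := 1) (by simp [hA])
  exact (Subgroup.zpowers_le.2 hnorm) ht

theorem isVirtuallyAbelian_one : IsVirtuallyAbelian (ExtGroup r 1 s A) := by
  refine isVirtuallyAbelian_of_normalizes one_pos ?_
  have : (t : ExtGroup r 1 s A) = 1 := by simpa using t_pow (r := r) (n := 1) (s := s) (A := A)
  rw [this]
  exact one_mem _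

theorem isVirtuallyAbelian_of_y_eq_one (hn : 0 < n) (hy : (y : ExtGroup r n s A) = 1) :
    IsVirtuallyAbelian (ExtGroup r n s A) := by
  refine isVirtuallyAbelian_of_normalizes hn ?_
  rw [hy, Subgroup.zpowers_one_eq_bot, Subgroup.normalizer_eq_top]
  trivial

/-- The case of two amalgamated factors both containing the amalgamated subgroup with index two. -/
theorem isVirtuallyAbelian_of_gcd_eq_two (hA : Int.gcd n A = 2) (hr : Odd r) (hs : Odd s)
    (hy : (y : ExtGroup r n s A) * y = 1) : IsVirtuallyAbelian (ExtGroup r n s A) := by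
  have hodd : ∀ k : ℤ, Odd k → (y : ExtGroup r n s A) ^ k = y := by
    rintro _ ⟨k, rfl⟩
    rw [zpow_add, zpow_mul, zpow_two, hy, one_zpow, one_mul, zpow_one]
  have hcomm : Commute (y : ExtGroup r n s A) (t ^ A) := by
    have h := relation_mul (r := r) (n := n) (s := s) (A := A)
    rwa [hodd r hr, hodd s hs] at h
  obtain ⟨k, hk⟩ := t_zpow_mem (r := r) (n := n) (s := s) (A := A) (k := 2) (by simp [hA])
  have hcomm2 : Commute (y : ExtGroup r n s A) (t * t) := by
    rw [← zpow_two, ← hk]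
    exact hcomm.zpow_right k
  refine isVirtuallyAbelian_of_involution (a := y) (b := t) (e := 1) ?_ hy ?_
  · rw [Set.pair_comm, closure_t_y]
  · rw [hcomm2.eq, mul_assoc, hy, zpow_one, mul_one]

/-- For even `A` the relation is `y ^ (r - s) = 1`, giving `ℤ/2 * ℤ/|r - s|`, which is large unless
`|r - s| = 2`. For odd `A`, conjugation by the involution `t` swaps `y ^ r` and `y ^ s`, and Bézout
shows that it normalizes `⟨y²⟩`. -/
theorem large_or_virtuallyAbelian_two (hk : Int.gcd r s = 2) :
    IsLarge (ExtGroup r 2 s A) ∨ IsVirtuallyAbelian (ExtGroup r 2 s A) := by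
  obtain ⟨r', s', hcop, hr', hs'⟩ : ∃ r' s' : ℤ, IsCoprime r' s' ∧ r = 2 * r' ∧ s = 2 * s' := by
    obtain ⟨r', s', h, h1, h2⟩ := Int.exists_gcd_one (m := r) (n := s) (by omega)
    rw [hk] at h1 h2
    exact ⟨r', s', Int.isCoprime_iff_gcd_eq_one.2 h, by rw [h1]; push_cast; ring,
      by rw [h2]; push_cast; ring⟩
  have htt : (t : ExtGroup r 2 s A) * t = 1 := by
    rw [← pow_two, t_pow]
  have htA : ∀ k : ℤ, (t : ExtGroup r 2 s A) ^ (2 * k) = 1 := fun k => by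
    rw [zpow_mul, zpow_two, htt, one_zpow]
  rcases Int.even_or_odd' A with ⟨A', rfl | rfl⟩
  · have hlarge : ∀ N : ℕ, 3 ≤ N → (N : ℤ) ∣ r - s → IsLarge (ExtGroup r 2 s (2 * A')) := by
      intro N hN hdvd
      have : NeZero N := ⟨by omega⟩
      refine isLarge_of_function_eq_one (N := N) (d := 2) (fun _ => 1) ?_ dvd_rfl
        ⟨A', by simp⟩ (by simp) le_rfl (by omega) (Or.inr hN)
      have := (ZMod.intCast_zmod_eq_zero_iff_dvd _ N).2 hdvd
      push_cast at this
      simpa using sub_eq_zero.1 this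
    by_cases h0 : r - s = 0
    · exact Or.inl (hlarge 3 le_rfl (by simp [h0]))
    by_cases h2 : (r - s).natAbs = 2
    · right
      have h := relation_mul (r := r) (n := 2) (s := s) (A := 2 * A')
      rw [htA, mul_one, one_mul] at h
      have hy : (y : ExtGroup r 2 s (2 * A')) * y = 1 := by
        have h1 : (y : ExtGroup r 2 s (2 * A')) ^ (r - s) = 1 := by
          rw [zpow_sub, h, mul_inv_cancel]
        rwa [← pow_natAbs_eq_one, h2, pow_two] at h1
      exact isVirtuallyAbelian_of_involution (a := t) (b := y) (e := 0) closure_t_y htt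
        (by rw [hy, mul_one, htt, zpow_zero])
    · exact Or.inl (hlarge (r - s).natAbs (by omega) (by simp))
  · right
    have h := relation_mul (r := r) (n := 2) (s := s) (A := 2 * A' + 1)
    rw [zpow_add, htA, one_mul, zpow_one] at h
    have hti : (t : ExtGroup r 2 s (2 * A' + 1))⁻¹ = t := inv_eq_of_mul_eq_one_left htt
    set z := (y : ExtGroup r 2 s (2 * A' + 1)) * y with hz
    have hzk : ∀ k : ℤ, y ^ (2 * k) = z ^ k := fun k => by rw [zpow_mul, zpow_two]
    have h1 : z ^ r' * t = t * z ^ s' := by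
      rw [← hzk, ← hzk, ← hr', ← hs', h]
    have h2 : t * z ^ s' * t⁻¹ = z ^ r' := by rw [← h1, mul_inv_cancel_right]
    have h3 : t * z ^ r' * t⁻¹ = z ^ s' := by
      rw [mul_assoc, hti, h1, ← mul_assoc, htt, one_mul]
    obtain ⟨i, j, hij⟩ := hcop
    refine isVirtuallyAbelian_of_involution (a := t) (b := y) (e := s' * i + r' * j) closure_t_y htt
      ?_
    have h4 : z = (z ^ r') ^ i * (z ^ s') ^ j := by
      rw [← zpow_mul, ← zpow_mul, ← zpow_add, mul_comm r', mul_comm s', hij, zpow_one]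
    calc t * z * t = t * ((z ^ r') ^ i * (z ^ s') ^ j) * t⁻¹ := by rw [← h4, hti]
      _ = (t * z ^ r' * t⁻¹) ^ i * (t * z ^ s' * t⁻¹) ^ j := by
        rw [conj_zpow, conj_zpow]; group
      _ = z ^ (s' * i + r' * j) := by rw [h2, h3, zpow_add, zpow_mul, zpow_mul]

theorem large_or_virtuallyAbelian (hn : 0 < n) :
    IsLarge (ExtGroup r n s A) ∨ IsVirtuallyAbelian (ExtGroup r n s A) := by
  have : NeZero n := ⟨hn.ne'⟩
  by_cases hn1 : n = 1
  · subst hn1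
    exact Or.inr isVirtuallyAbelian_one
  by_cases hrs : IsCoprime r s
  · by_cases hd1 : Int.gcd n A = 1
    · exact Or.inr (isVirtuallyAbelian_of_gcd_eq_one hn hd1 hrs)
    have hdpos : 0 < Int.gcd n A := Int.gcd_pos_of_ne_zero_left _ (by exact_mod_cast hn.ne')
    obtain ⟨m', A', hcop, hm', hA'⟩ := Int.exists_gcd_one hdpos
    set d := Int.gcd n A with hd
    obtain ⟨m, rfl⟩ : ∃ m : ℕ, m' = m := by
      refine ⟨m'.toNat, (Int.toNat_of_nonneg ?_).symm⟩
      have : (0 : ℤ) < m' * d := by rw [← hm']; exact_mod_cast hn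
      exact (pos_of_mul_pos_left this (by positivity)).le
    have hnm : n = d * m := by
      rw [mul_comm]
      exact_mod_cast hm'
    have hm0 : m ≠ 0 := by
      rintro rfl
      omega
    have hA : A = d * A' := by rw [hA', mul_comm]
    have hcopA : IsCoprime A' (m : ℤ) := (Int.isCoprime_iff_gcd_eq_one.2 hcop).symm
    have hrN : IsCoprime r (r ^ m - s ^ m) := isCoprime_pow_sub_pow hrs hm0
    have hu : ((t : ExtGroup r n s A) ^ A) ^ m = 1 := by
      rw [← zpow_natCast, ← zpow_mul, hA]
      have : (d : ℤ) * A' * m = n * A' := by rw [hnm]; push_cast; ring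
      rw [this, zpow_mul, zpow_natCast, t_pow, one_zpow]
    have hy : (y : ExtGroup r n s A) ^ (r ^ m - s ^ m).natAbs = 1 := by
      rw [pow_natAbs_eq_one]
      exact zpow_sub_eq_one relation_mul hu
    set N := (r ^ m - s ^ m).natAbs with hN
    -- When `r ^ m = s ^ m`, coprimality makes `r` a unit and every modulus divides the difference;
    -- `3` is large enough.
    by_cases hN0 : N = 0
    · rw [Int.natAbs_eq_zero.1 hN0, isCoprime_zero_right] at hrN
      exact Or.inl (isLarge_of_coprime hnm hA hcopA (N := 3) (by
          obtain ⟨v, hv⟩ := hrN.exists_left_inv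
          exact ⟨v, 0, by simpa using hv⟩)
        (by rw [Int.natAbs_eq_zero.1 hN0]; simp) (by omega) (by norm_num) (by norm_num))
    by_cases hN1 : N = 1
    · rw [hN1, pow_one] at hy
      exact Or.inr (isVirtuallyAbelian_of_y_eq_one hn hy)
    by_cases h22 : d = 2 ∧ N = 2
    · right
      rw [h22.2, pow_two] at hy
      have hpar : Even (r ^ m - s ^ m) := by
        rw [← Int.natAbs_even, ← hN, h22.2]
        exact even_two
      have hnot : ¬ (Even r ∧ Even s) := by
        rintro ⟨h1, h2⟩
        have := hrs.isUnit_of_dvd' h1.two_dvd h2.two_dvd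
        revert this
        decide
      rw [Int.even_sub, Int.even_pow' hm0, Int.even_pow' hm0] at hpar
      refine isVirtuallyAbelian_of_gcd_eq_two h22.1 ?_ ?_ hy
      · rw [← Int.not_even_iff_odd]
        tauto
      · rw [← Int.not_even_iff_odd]
        tauto
    · left
      refine isLarge_of_coprime hnm hA hcopA (N := N) ?_ ?_ (by omega) (by omega) (by omega)
      · rwa [hN, Int.natCast_natAbs, IsCoprime.abs_right_iff]
      · rw [hN, Int.natCast_natAbs, abs_dvd]
  · rw [Int.isCoprime_iff_gcd_eq_one] at hrs
    by_cases h0 : Int.gcd r s = 0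
    · rw [Int.gcd_eq_zero_iff] at h0
      exact Or.inl (isLarge_of_common_divisor (k := 3) (by simp [h0.1]) (by simp [h0.2]) (by omega)
        (by norm_num) (by norm_num))
    by_cases h22 : n = 2 ∧ Int.gcd r s = 2
    · obtain ⟨rfl, h⟩ := h22
      exact large_or_virtuallyAbelian_two h
    · exact Or.inl (isLarge_of_common_divisor (Int.gcd_dvd_left r s) (Int.gcd_dvd_right r s)
        (by omega) (by omega) (by omega))

end ExtGroup

/-! ### Embedding `G_n(w)` in `E` as a subgroup of finite index. -/

theorem shift_zpow_of {n : ℕ} (k : ℤ) (i : ZMod n) :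
    (shift n ^ k) (FreeGroup.of i) = FreeGroup.of (i + k) := by
  have h := zpow_eq_of_map_add
    (fun k : ℤ => (FreeGroup.freeGroupCongr (Equiv.addRight (k : ZMod n)) :
      MulAut (FreeGroup (ZMod n)))) (fun a b => by
        apply MulEquiv.toMonoidHom_injective
        ext j
        simp [add_comm, add_left_comm]) k
  simp only [Int.cast_one] at h
  rw [shift, h]
  simp

section Conjugates

variable {n : ℕ} {Γ : Type*} [Group Γ] (a b : Γ) (f : ℤ)

/-- The homomorphism with `x_i ↦ a^i (b a^{-f}) a^{-i}`. -/
def conjLift (n : ℕ) : FreeGroup (ZMod n) →* Γ :=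
  FreeGroup.lift fun i => a ^ i.val * (b * a ^ (-f)) * (a ^ i.val)⁻¹

variable {a}

theorem zpow_val_intCast [NeZero n] (ha : a ^ n = 1) (k : ℤ) : a ^ ((k : ZMod n).val) = a ^ k := by
  rw [← zpow_natCast, ZMod.val_intCast]
  exact (zpow_eq_zpow_emod' k ha).symm

theorem conjLift_of_intCast [NeZero n] (ha : a ^ n = 1) (k : ℤ) :
    conjLift a b f n (FreeGroup.of (k : ZMod n)) = a ^ k * (b * a ^ (-f)) * (a ^ k)⁻¹ := by
  rw [conjLift, FreeGroup.lift_apply_of, zpow_val_intCast ha]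

theorem conjLift_shift [NeZero n] (ha : a ^ n = 1) (k : ℤ) (v : FreeGroup (ZMod n)) :
    conjLift a b f n ((shift n ^ k) v) = a ^ k * conjLift a b f n v * (a ^ k)⁻¹ := by
  have : (conjLift a b f n).comp (shift n ^ k).toMonoidHom =
      (MulAut.conj (a ^ k)).toMonoidHom.comp (conjLift a b f n) := by
    ext i
    obtain ⟨i, rfl⟩ := ZMod.intCast_surjective i
    simp only [MonoidHom.comp_apply, MulEquiv.coe_toMonoidHom, shift_zpow_of, MulAut.conj_apply]
    rw [← Int.cast_add, conjLift_of_intCast b f ha, conjLift_of_intCast b f ha]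
    group
  exact DFunLike.congr_fun this v

theorem block_succ (n k : ℕ) (f : ℤ) :
    block n (k + 1) f = block n k f * FreeGroup.of ((k * f : ℤ) : ZMod n) := by
  simp [block, List.range_succ]

/-- The product telescopes: the `i`-th factor is `a ^ (i f) * b * a ^ (-(i + 1) f)`. -/
theorem conjLift_block [NeZero n] (ha : a ^ n = 1) (k : ℕ) :
    conjLift a b f n (block n k f) = b ^ k * a ^ (-(k * f)) := by
  induction k with
  | zero => simp [block]
  | succ k ih =>
    rw [block_succ, map_mul, ih, conjLift_of_intCast b f ha, pow_succ]
    push_cast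
    group

theorem conjLift_wordM [NeZero n] (ha : a ^ n = 1) {r : ℕ} {s : ℤ} (A : ℤ)
    (h : f * ((r : ℤ) - s) ≡ 0 [ZMOD n]) :
    conjLift a b f n (wordM r n s f A) = b ^ (r : ℤ) * a ^ A * b ^ (-s) * a ^ (-A) := by
  have hf : a ^ (r * f) = a ^ (s * f) := by
    obtain ⟨k, hk⟩ := (Int.modEq_zero_iff_dvd).1 h
    have : (r : ℤ) * f = s * f + n * k := by linear_combination hk
    rw [this, zpow_add, zpow_mul a (n : ℤ), zpow_natCast, ha, one_zpow, mul_one]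
  unfold wordM
  split_ifs with hs
  · obtain ⟨s, rfl⟩ := Int.eq_ofNat_of_zero_le hs
    rw [map_mul, map_inv, conjLift_shift b f ha, conjLift_block b f ha, conjLift_block b f ha,
      zpow_neg, hf]
    simp only [Int.natAbs_natCast]
    group
  · obtain ⟨s, rfl⟩ : ∃ k : ℕ, s = -k := ⟨s.natAbs, by omega⟩
    have hf' : a ^ (s * f : ℤ) = a ^ (-(r * f : ℤ)) := by
      rw [zpow_neg, hf, ← zpow_neg]
      congr 1
      ring
    rw [map_mul, conjLift_shift b f ha, conjLift_block b f ha, conjLift_block b f ha]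
    simp only [Int.natAbs_neg, Int.natAbs_natCast]
    rw [zpow_neg _ (s * f : ℤ), hf']
    group

end Conjugates

namespace CycPresGroup

variable {n : ℕ} [NeZero n] {w : FreeGroup (ZMod n)}

theorem shift_pow_self (n : ℕ) : shift n ^ n = 1 := by
  apply MulEquiv.toMonoidHom_injective
  ext i
  simpa using shift_zpow_of (n : ℤ) i

theorem mk_shift (k : ℤ) : PresentedGroup.mk (relators n w) ((shift n ^ k) w) = 1 := by
  apply PresentedGroup.one_of_mem
  have hn : (0 : ℤ) < n := by exact_mod_cast NeZero.pos n
  refine ⟨(k % n).toNat, ?_, ?_⟩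
  · have := Int.emod_lt_of_pos k hn
    have := Int.emod_nonneg k hn.ne'
    omega
  · rw [← zpow_natCast, Int.toNat_of_nonneg (Int.emod_nonneg k hn.ne'),
      ← zpow_eq_zpow_emod' k (shift_pow_self n)]

/-- The endomorphism `x_j ↦ x_{j+i}`. -/
def shiftHom (w : FreeGroup (ZMod n)) (i : ZMod n) : CycPresGroup n w →* CycPresGroup n w :=
  PresentedGroup.toGroup (f := fun j => PresentedGroup.of (j + i)) (by
    rintro _ ⟨k, -, rfl⟩
    have h : ∀ v, FreeGroup.lift (fun j => (PresentedGroup.of (j + i) : CycPresGroup n w)) v =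
        PresentedGroup.mk (relators n w) ((shift n ^ (i.val : ℤ)) v) := by
      intro v
      refine DFunLike.congr_fun (f := FreeGroup.lift _)
        (g := (PresentedGroup.mk (relators n w)).comp (shift n ^ (i.val : ℤ)).toMonoidHom) ?_ v
      ext j
      simp [shift_zpow_of, PresentedGroup.of]
    rw [h, ← zpow_natCast, ← MulAut.mul_apply, ← zpow_add, mk_shift])

@[simp]
theorem shiftHom_of (i j : ZMod n) :
    shiftHom w i (PresentedGroup.of j) = PresentedGroup.of (j + i) :=
  PresentedGroup.toGroup.of _

/-- The action of `ℤ/n` on `G_n(w)` by shifts. -/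
def shiftAction (w : FreeGroup (ZMod n)) :
    Multiplicative (ZMod n) →* MulAut (CycPresGroup n w) :=
  MonoidHom.mk' (fun i => MonoidHom.toMulEquiv (shiftHom w i.toAdd) (shiftHom w (-i.toAdd))
      (by ext j; simp) (by ext j; simp)) (fun i k => by
    apply MulEquiv.toMonoidHom_injective
    ext j
    simp [add_comm, add_left_comm])

theorem shiftAction_of (i j : ZMod n) :
    shiftAction w (Multiplicative.ofAdd i) (PresentedGroup.of j) = PresentedGroup.of (j + i) :=
  shiftHom_of i j

variable {r : ℕ} {s f A : ℤ} (h : f * ((r : ℤ) - s) ≡ 0 [ZMOD n])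

/-- The homomorphism `G_n(w) → E` with `x_i ↦ t^i (y t^{-f}) t^{-i}`. -/
def toExt (A : ℤ) : CycPresGroup n (wordM r n s f A) →* ExtGroup r n s A :=
  PresentedGroup.toGroup (f := fun i => ExtGroup.t ^ i.val *
      (ExtGroup.y * ExtGroup.t ^ (-f)) * (ExtGroup.t ^ i.val)⁻¹) (by
    rintro _ ⟨k, -, rfl⟩
    rw [← zpow_natCast]
    refine (conjLift_shift ExtGroup.y f ExtGroup.t_pow _ _).trans ?_
    rw [conjLift_wordM ExtGroup.y f ExtGroup.t_pow A h, ExtGroup.relation, mul_one,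
      mul_inv_cancel])

theorem toExt_of_intCast (k : ℤ) :
    toExt h A (PresentedGroup.of (k : ZMod n)) = ExtGroup.t ^ k *
      (ExtGroup.y * ExtGroup.t ^ (-f)) * (ExtGroup.t ^ k)⁻¹ := by
  rw [toExt, PresentedGroup.toGroup.of, zpow_val_intCast ExtGroup.t_pow]

theorem toExt_shiftHom (k : ℤ) (g : CycPresGroup n (wordM r n s f A)) :
    toExt h A (shiftHom _ (k : ZMod n) g) =
      ExtGroup.t ^ k * toExt h A g * (ExtGroup.t ^ k)⁻¹ := by
  have : (toExt h A).comp (shiftHom _ (k : ZMod n)) =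
      (MulAut.conj (ExtGroup.t ^ k)).toMonoidHom.comp (toExt h A) := by
    ext i
    obtain ⟨i, rfl⟩ := ZMod.intCast_surjective i
    simp only [MonoidHom.comp_apply, MulEquiv.coe_toMonoidHom, shiftHom_of, MulAut.conj_apply]
    rw [← Int.cast_add, toExt_of_intCast, toExt_of_intCast]
    group
  exact DFunLike.congr_fun this g

/-- The relations of `E` hold in `G_n(w) ⋊ ℤ/n`, with `t` the shift and `y = x_0 t^f`; the composite
`G_n(w) → E → G_n(w) ⋊ ℤ/n` is the canonical inclusion. -/
theorem toExt_injective : Function.Injective (toExt h A) := by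
  set w := wordM r n s f A with hw
  let a : CycPresGroup n w ⋊[shiftAction w] Multiplicative (ZMod n) :=
    SemidirectProduct.inr (Multiplicative.ofAdd 1)
  let b : CycPresGroup n w ⋊[shiftAction w] Multiplicative (ZMod n) :=
    SemidirectProduct.inl (PresentedGroup.of 0) *
      SemidirectProduct.inr (Multiplicative.ofAdd (f : ZMod n))
  have hak : ∀ k : ℤ, a ^ k = SemidirectProduct.inr (Multiplicative.ofAdd (k : ZMod n)) := by
    intro k
    rw [← map_zpow, ← ofAdd_zsmul]
    simp
  have ha : a ^ n = 1 := by
    rw [← zpow_natCast, hak]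
    simp
  have hab : ∀ k : ℤ, a ^ k * (b * a ^ (-f)) * (a ^ k)⁻¹ =
      SemidirectProduct.inl (PresentedGroup.of (k : ZMod n)) := by
    intro k
    have h1 : b * a ^ (-f) = SemidirectProduct.inl (PresentedGroup.of 0) := by
      rw [zpow_neg, hak]
      exact mul_inv_cancel_right _ _
    rw [h1, hak, ← map_inv, ← SemidirectProduct.inl_aut, shiftAction_of, zero_add]
  have hlift : conjLift a b f n =
      SemidirectProduct.inl.comp (PresentedGroup.mk (relators n w)) := by
    ext1 i
    obtain ⟨i, rfl⟩ := ZMod.intCast_surjective i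
    rw [conjLift_of_intCast b f ha, hab]
    rfl
  have hrel : b ^ (r : ℤ) * a ^ A * b ^ (-s) * a ^ (-A) = 1 := by
    rw [← conjLift_wordM b f ha A h, hlift, MonoidHom.comp_apply, ← hw]
    have := mk_shift (w := w) 0
    rw [zpow_zero, MulAut.one_apply] at this
    rw [this, map_one]
  have hcomp : (ExtGroup.lift a b ha hrel).comp (toExt h A) = SemidirectProduct.inl := by
    ext1 i
    obtain ⟨i, rfl⟩ := ZMod.intCast_surjective i
    rw [MonoidHom.comp_apply, toExt_of_intCast]
    simp only [map_mul, map_inv, map_zpow, ExtGroup.lift_t, ExtGroup.lift_y]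
    exact hab i
  refine Function.Injective.of_comp (f := ExtGroup.lift a b ha hrel) ?_
  rw [← MonoidHom.coe_comp, hcomp]
  exact SemidirectProduct.inl_injective

/-- Conjugation by `t` is the shift, so the image is normal. It contains `y t^{-f}`, so the quotient
is generated by the class of `t`, of finite order. -/
theorem toExt_range_finiteIndex : (toExt h A).range.FiniteIndex := by
  have hx : ExtGroup.y * ExtGroup.t ^ (-f) ∈ (toExt h A).range :=
    ⟨PresentedGroup.of ((0 : ℤ) : ZMod n), by rw [toExt_of_intCast]; simp⟩
  have ht : ExtGroup.t ∈ Subgroup.normalizer ((toExt h A).range : Set (ExtGroup r n s A)) := by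
    rw [Subgroup.mem_normalizer_iff]
    refine fun g => ⟨?_, ?_⟩
    · rintro ⟨g, rfl⟩
      refine ⟨shiftHom _ ((1 : ℤ) : ZMod n) g, ?_⟩
      rw [toExt_shiftHom, zpow_one]
    · rintro ⟨g', hg'⟩
      refine ⟨shiftHom _ ((-1 : ℤ) : ZMod n) g', ?_⟩
      rw [toExt_shiftHom, hg']
      group
  have hnormal : (toExt h A).range.Normal := by
    rw [← Subgroup.normalizer_eq_top_iff, eq_top_iff, ← ExtGroup.closure_t_y, Subgroup.closure_le]
    rintro _ (rfl | rfl)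
    · exact ht
    · have := mul_mem (Subgroup.le_normalizer hx) (zpow_mem ht f)
      rwa [zpow_neg, inv_mul_cancel_right] at this
  have hfin := (QuotientGroup.mk' (toExt h A).range).isOfFinOrder
    (ExtGroup.isOfFinOrder_t (NeZero.pos n))
  have : Finite (Subgroup.zpowers (QuotientGroup.mk' (toExt h A).range ExtGroup.t)) := by
    exact hfin.finite_zpowers
  refine finiteIndex_of_generators ExtGroup.closure_t_y
    (Subgroup.zpowers (QuotientGroup.mk' (toExt h A).range ExtGroup.t))
    (Subgroup.mem_zpowers _) ⟨f, ?_⟩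
  have h1 := (QuotientGroup.eq_one_iff _).2 hx
  rw [QuotientGroup.mk_mul, QuotientGroup.mk_zpow, zpow_neg, mul_inv_eq_one] at h1
  exact h1.symm

theorem large_or_virtuallyAbelian (h : f * ((r : ℤ) - s) ≡ 0 [ZMOD n]) :
    IsLarge (CycPresGroup n (wordM r n s f A)) ∨
      IsVirtuallyAbelian (CycPresGroup n (wordM r n s f A)) :=
  have := toExt_range_finiteIndex h (A := A)
  large_or_virtuallyAbelian_of_injective (toExt h A) (toExt_injective h)
    (ExtGroup.large_or_virtuallyAbelian (NeZero.pos n))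

end CycPresGroup

/-! ### Groups of type `𝔐` and the final statement. -/

theorem IsTypeM.exists_wordM {G : Type*} [Group G] (hG : IsTypeM G) :
    ∃ (r n : ℕ) (s f A : ℤ), 0 < n ∧ f * ((r : ℤ) - s) ≡ 0 [ZMOD n] ∧
      Nonempty (G ≃* CycPresGroup n (wordM r n s f A)) := by
  obtain ⟨n, r₁, r₂, a, f, ε, hn, -, hf, hG⟩ := hG
  rcases Int.units_eq_one_or ε with rfl | rfl
  -- For negative `s`, `wordM` shifts the second block by `A + f r`, hence the correction `- f *
  -- r₁`. If `r₂ = 0` the other branch applies, but the block is empty.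
  · refine ⟨r₁, n, -r₂, f, a - f * r₁, hn, ?_, ?_⟩
    · convert hf using 1
      push_cast
      ring
    · have hw : wordM r₁ n (-r₂) f (a - f * r₁) =
          block n r₁ f * ((shift n ^ a) (block n r₂ f)) ^ ((1 : ℤˣ) : ℤ) := by
        rcases Nat.eq_zero_or_pos r₂ with rfl | h2
        · simp [wordM, block]
        · simp [wordM, h2.ne']
      rwa [hw]
  · refine ⟨r₁, n, r₂, f, a, hn, ?_, ?_⟩
    · convert hf using 1
      push_cast
      ring
    · have hw : wordM r₁ n r₂ f a =
          block n r₁ f * ((shift n ^ a) (block n r₂ f)) ^ ((-1 : ℤˣ) : ℤ) := by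
        simp [wordM]
      rwa [hw]

end CycPres

theorem mainTheorem10 :
    (∀ (r n : ℕ) (s f A : ℤ), 0 < n → ∀ h : f * ((r : ℤ) - s) ≡ 0 [ZMOD n],
      (CycPres.IsLarge (CycPres.ExtGroup r n s A) ∨
        CycPres.IsVirtuallyAbelian (CycPres.ExtGroup r n s A)) ∧
      (CycPres.IsLarge (CycPres.retraction A h).ker ∨
        CycPres.IsVirtuallyAbelian (CycPres.retraction A h).ker) ∧
      (CycPres.IsLarge (CycPres.CycPresGroup n (CycPres.wordM r n s f A)) ∨
        CycPres.IsVirtuallyAbelian (CycPres.CycPresGroup n (CycPres.wordM r n s f A)))) ∧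
    (∀ (G : Type*) [Group G], CycPres.IsTypeM G →
      CycPres.IsLarge G ∨ CycPres.IsVirtuallyAbelian G) := by
  refine ⟨fun r n s f A hn h => ?_, fun G _ hG => ?_⟩
  · have : NeZero n := ⟨hn.ne'⟩
    have hE := CycPres.ExtGroup.large_or_virtuallyAbelian (r := r) (s := s) (A := A) hn
    have hfin : Finite (Multiplicative (ZMod n)) := inferInstance
    have hker : (CycPres.retraction A h).ker.subtype.range.FiniteIndex := by
      rw [Subgroup.range_subtype]
      infer_instance
    exact ⟨hE, CycPres.large_or_virtuallyAbelian_of_injective _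
      (Subgroup.subtype_injective _) hE, CycPres.CycPresGroup.large_or_virtuallyAbelian h⟩
  · obtain ⟨r, n, s, f, A, hn, h, ⟨e⟩⟩ := hG.exists_wordM
    have : NeZero n := ⟨hn.ne'⟩
    exact CycPres.large_or_virtuallyAbelian_of_mulEquiv e
      (CycPres.CycPresGroup.large_or_virtuallyAbelian h)
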